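/- A \emph{box} is a family of numbers $P(a,b\,|\,x,y)$, $a,b,x,y\in\{0,1\}$, that for each $(x,y)$ is a probability distribution in $(a,b)$; $\mathcal{NS}\subset\mathbb{R}^{16}$ is the set of non-signalling boxes (the marginal of $a$ does not depend on $y$, and that of $b$ does not depend on $x$). Let $$\mathrm{CHSH}(P)=\tfrac14\sum_{a\oplus b=xy}P(a,b|x,y),\qquad \mathrm{CHSH}'(P)=\tfrac14\sum_{a\oplus b=(x\oplus1)(y\oplus1)}P(a,b|x,y).$$ Let $\mathtt{PR}(a,b|x,y)=\frac12$ if $a\oplus b=xy$ and $0$ otherwise, $\mathtt{SR}(a,b|x,y)=\frac12$ if $a=b$ and $0$ otherwise, $\mathtt{I}(a,b|x,y)=\frac14$, and let $\mathcal A\subset\mathbb R^{16}$ be the affine plane through $\mathtt{PR},\mathtt{SR},\mathtt{I}$. The product of the Brunner--Skrzypczyk wiring is $$(P\boxtimes Q)(a,b|x,y)=\sum_{a_1\oplus a_2=a,\ b_1\oplus b_2=b}P(a_1,b_1|x,y)\,Q(a_2,b_2|x a_1,y b_1),$$ and $P^{\boxtimes 1}=P$, $P^{\boxtimes (k+1)}=P^{\boxtimes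 k}\boxtimes P$. For $\eta_{xy}=2\,\mathbb P(a\oplus b=xy\,|\,x,y)-1$ put $A=(\eta_{00}+\eta_{01}+\eta_{10}+\eta_{11})^2$ and $B=2\eta_{00}^2+4\eta_{01}\eta_{10}+2\eta_{11}^2$. A non-signalling box $P$ \emph{collapses communication complexity} if there is $p>\frac12$ such that for all $n$ and all $f:\{0,1\}^n\times\{0,1\}^n\to\{0,1\}$ there is a protocol with finitely many copies of $P$ (each party feeds its ends of the copies in an order and with inputs that may depend adaptively on its own data), shared randomness, and a single bit sent from Bob to Alice, after which Alice, who knows only $X$, outputs $f(X,Y)$, where Bob knows only $Y$, with probability at least $p$, for all $X,Y$. \textbf{Theorem (New collapsing boxes).} Every $Q\in\mathcal{NS}$ with $\mathrm{CHSH}(Q)>\frac{3+\sqrt6}{6}$ collapses communication complexity (the threshold of Brassard et al.). There is exactly one $P\in\mathcal A$ with $(\mathrm{CHSH}'(P),\mathrm{CHSH}(P))=(0.627,\,0.862)$. It is a non-signalling box, it collapses communication complexity, and $$0.9135<\mathrm{CHSH}(P^{\boxtimes5})<0.9136,\qquad \mathrm{CHSH}(P^{\boxtimes5})>\tfrac{3+\sqrt6}{6}.$$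 Moreover $P$ lies outside the previously known collapsing regions: (i) $P\ne\mathtt{PR}$ (van Dam); (ii) $\mathrm{CHSH}(P)<\frac{3+\sqrt6}{6}$ (Brassard et al.); (iii) $|A+B-14.13|<0.005$, so $A+B<16$ (Botteron--Broadbent--Proulx, region $A+B>16$); (iv) $P$ is not in the relative boundary of $\mathcal{NS}$, i.e. the boundary within its affine hull (Brito et al., whose regions lie in that boundary); (v) for $Q_1=P$, $Q_{n+1}=Q_n\boxtimes Q_n$, one has $\mathrm{CHSH}(Q_n)\le\frac{3+\sqrt6}{6}$ for all $n\ge1$ (pairwise iteration of Brunner--Skrzypczyk). -/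

import Mathlib

namespace NonlocalBox

/-! ### Bipartite boxes with binary inputs and outputs -/

/-- `P a b x y` is the number `P(a, b | x, y)`: Alice inputs `x` and receives `a`, Bob inputs `y`
and receives `b`. The type is the ambient space `ℝ¹⁶`; the genuine boxes are the elements of the
set `NS` below. -/
abbrev Box : Type := Bool → Bool → Bool → Bool → ℝ

/-- The set of non-signalling boxes: conditional probability distributions in which the marginal of
each party does not depend on the input of the other party. -/
def NS : Set Box :=
  {P | (∀ a b x y, 0 ≤ P a b x y) ∧
    (∀ x y, ∑ a, ∑ b, P a b x y = 1) ∧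
    (∀ a x y y', ∑ b, P a b x y = ∑ b, P a b x y') ∧
    (∀ b x x' y, ∑ a, P a b x y = ∑ a, P a b x' y)}

/-- The box `PR`: uniform on the pairs with `a ⊕ b = x y`. -/
noncomputable def boxPR : Box := fun a b x y => if xor a b = (x && y) then 1 / 2 else 0

/-- The box `P₀` that always outputs `(0, 0)`. -/
noncomputable def boxP0 : Box := fun a b _ _ => if a = false ∧ b = false then 1 else 0

/-- The box `P₁` that always outputs `(1, 1)`. -/
noncomputable def boxP1 : Box := fun a b _ _ => if a = true ∧ b = true then 1 else 0

/-- The shared randomness box `SR = (P₀ + P₁) / 2`. -/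
noncomputable def boxSR : Box := (1 / 2 : ℝ) • (boxP0 + boxP1)

/-- The box `I`: uniform and independent outputs. -/
noncomputable def boxI : Box := fun _ _ _ _ => 1 / 4

/-- The plane `𝒜 = Aff {PR, SR, I}`. -/
noncomputable def planeA : AffineSubspace ℝ Box := affineSpan ℝ {boxPR, boxSR, boxI}

/-- The winning probability at the CHSH game, whose rule is `a ⊕ b = x y`. -/
noncomputable def CHSH (P : Box) : ℝ :=
  (1 / 4) * ∑ a, ∑ b, ∑ x, ∑ y, if xor a b = (x && y) then P a b x y else 0

/-- The winning probability at the game whose rule is `a ⊕ b = (x ⊕ 1) (y ⊕ 1)`. -/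
noncomputable def CHSH' (P : Box) : ℝ :=
  (1 / 4) * ∑ a, ∑ b, ∑ x, ∑ y, if xor a b = (!x && !y) then P a b x y else 0

/-! ### The box product induced by the Brunner-Skrzypczyk wiring -/

/-- The product `P ⊠ Q`. On inputs `x, y` the parties use `P` on `x, y`, getting `a₁, b₁`, then use
`Q` on `x a₁, y b₁`, getting `a₂, b₂`, and output `a = a₁ ⊕ a₂` and `b = b₁ ⊕ b₂`. -/
noncomputable def mul (P Q : Box) : Box := fun a b x y =>
  ∑ a₁, ∑ b₁, ∑ a₂, ∑ b₂,
    if xor a₁ a₂ = a ∧ xor b₁ b₂ = b then P a₁ b₁ x y * Q a₂ b₂ (x && a₁) (y && b₁) else 0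

/-- `P^{⊠ k} = (((P ⊠ P) ⊠ P) ⋯ ) ⊠ P` with `k` factors, for `k ≥ 1`. -/
noncomputable def rightPow (P : Box) (k : ℕ) : Box := (fun Q => mul Q P)^[k - 1] P

/-- The pairwise iteration `Q₁ = P`, `Qₙ₊₁ = Qₙ ⊠ Qₙ`, for `n ≥ 1`. -/
noncomputable def pairwiseIter (P : Box) (n : ℕ) : Box := (fun Q => mul Q Q)^[n - 1] P

/-! ### Biases -/

/-- The bias `η_{x y} = 2 ℙ(a ⊕ b = x y | x, y) - 1`. -/
noncomputable def bias (P : Box) (x y : Bool) : ℝ :=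
  2 * (∑ a, ∑ b, if xor a b = (x && y) then P a b x y else 0) - 1

/-- `A = (η₀₀ + η₀₁ + η₁₀ + η₁₁)²`. -/
noncomputable def biasA (P : Box) : ℝ :=
  (bias P false false + bias P false true + bias P true false + bias P true true) ^ 2

/-- `B = 2 η₀₀² + 4 η₀₁ η₁₀ + 2 η₁₁²`. -/
noncomputable def biasB (P : Box) : ℝ :=
  2 * bias P false false ^ 2 + 4 * (bias P false true * bias P true false)
    + 2 * bias P true true ^ 2

/-! ### Communication complexity assisted by copies of a box -/

/-- The behaviour of one party who holds her ends of copies of a box, labelled by `ι`: a finite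
decision tree. At `use i x next` the party inputs `x` into the copy `i` and goes on with `next r`,
where `r` is the output bit of that copy; at `output o` she stops. The copies may be used in any
order, chosen adaptively and independently of the other party. Each copy accepts one input only: a
later `use` of the same copy just reads its recorded output bit again. -/
inductive Strategy (ι O : Type) : Type
  | output (o : O) : Strategy ι O
  | use (i : ι) (x : Bool) (next : Bool → Strategy ι O) : Strategy ι O

/-- The final output of a strategy, if the copies have the output bits `r`. -/
def Strategy.result {ι O : Type} (r : ι → Bool) : Strategy ι O → O
  | .output o => o
  | .use i _ next => (next (r i)).result r

/-- The bit that is input into the copy `j` if the copies have the output bits `r`: that of the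
first `use` of `j` along the run, and `0` if `j` is never used. -/
def Strategy.input {ι O : Type} [DecidableEq ι] (r : ι → Bool) (j : ι) : Strategy ι O → Bool
  | .output _ => false
  | .use i x next => if i = j then x else (next (r i)).input r j

/-- A protocol for inputs `X, Y ∈ {0,1}ⁿ` with finitely many copies of a box, a shared random
variable of finite range, and one bit of communication, sent by Bob to Alice. Bob's strategy, which
depends on `Y` and on the shared randomness, ends with the bit that he sends. Alice's strategy
depends on `X`, on the shared randomness and on the bit received, and ends with her guess. -/
structure Protocol (n : ℕ) where
  Copy : Type
  [fintypeCopy : Fintype Copy]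
  [decidableEqCopy : DecidableEq Copy]
  Rand : Type
  [fintypeRand : Fintype Rand]
  prob : Rand → ℝ
  prob_nonneg : ∀ r, 0 ≤ prob r
  prob_sum : ∑ r, prob r = 1
  alice : (Fin n → Bool) → Rand → Bool → Strategy Copy Bool
  bob : (Fin n → Bool) → Rand → Strategy Copy Bool

attribute [instance] Protocol.fintypeCopy Protocol.decidableEqCopy Protocol.fintypeRand

/-- The probability that the copies of `P` give Alice the bits `a` and Bob the bits `b`, and that
Alice's guess is then `v`, summed over all `a`, `b`: the probability that Alice outputs `v` on the
inputs `X, Y`. -/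
noncomputable def Protocol.outputProb {n : ℕ} (π : Protocol n) (P : Box) (X Y : Fin n → Bool)
    (v : Bool) : ℝ :=
  ∑ r, π.prob r * ∑ a : π.Copy → Bool, ∑ b : π.Copy → Bool,
    let B := π.bob Y r
    let A := π.alice X r (B.result b)
    if A.result a = v then ∏ i, P (a i) (b i) (A.input a i) (B.input b i) else 0

/-- `P` collapses communication complexity: for some `p > 1/2`, every Boolean function of two
strings, of any length, is computed by Alice with probability at least `p` on all inputs, with
finitely many copies of `P`, shared randomness and one bit of communication. -/
def Collapses (P : Box) : Prop :=
  ∃ p : ℝ, 1 / 2 < p ∧ ∀ (n : ℕ) (f : (Fin n → Bool) → (Fin n → Bool) → Bool),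
    ∃ π : Protocol n, ∀ X Y : Fin n → Bool, p ≤ π.outputProb P X Y (f X Y)

end NonlocalBox

/-! Collapse is proved by amplifying a bias. Say that Alice's and Bob's bits have bias `δ` for `f`
if their XOR has correlation `δ * sign (f X Y)`; Bob's one bit then lets Alice succeed with
probability `(1 + δ) / 2`. Guessing Bob's whole input gives bias `2⁻ⁿ` (`correlates_guess`).
Twirling turns a box into a noisy `PR` of correlation `θ = 2 CHSH - 1`
(`Realizes.correlates_twirl`), and two of these compute the majority of three distributed bits,
which sends `δ` to `θ² (3δ - δ³) / 2` (`Correlates.majority`). The slope at zero exceeds one when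
`θ² > 2/3`, that is, when `CHSH > (3 + √6) / 6`, and then the bias climbs past a constant
independent of `n` and `f` (`collapses_of_correlates`).

Since wirings are themselves protocols on copies of `P`, it is enough that some power of `P` passes
the threshold (`collapses_of_rightPow`). The plane has coordinates `(s, t)` in which the product is
explicit (`mul_planeBox`), and the box is `(0.978, 0.038)`. The fifth power keeps `s⁵` large while
`t` has dropped far below zero. Squaring passes only through powers of two in `s`: the first four
iterates are computed, and afterwards `s` is too small whatever `t` is. -/

namespace NonlocalBox

/-! ### Running two strategies against each other -/

namespace Strategy

variable {ι κ O O' : Type}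

/-- Apply a function to the output of a strategy. -/
def map (g : O → O') : Strategy ι O → Strategy ι O'
  | .output o => .output (g o)
  | .use i x next => .use i x fun r => (next r).map g

/-- Rename the copies used by a strategy. -/
def relabel (g : ι → κ) : Strategy ι O → Strategy κ O
  | .output o => .output o
  | .use i x next => .use (g i) x fun r => (next r).relabel g

/-- Run a strategy and then, on fresh copies, one that depends on its output. -/
def bind (k : O → Strategy κ O') : Strategy ι O → Strategy (ι ⊕ κ) O'
  | .output o => (k o).relabel Sum.inr
  | .use i x next => .use (Sum.inl i) x fun r => (next r).bind k

@[simp] theorem result_map (g : O → O') (r : ι → Bool) (S : Strategy ι O) :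
    (S.map g).result r = g (S.result r) := by
  induction S with
  | output o => rfl
  | use i x next ih => exact ih _

@[simp] theorem input_map [DecidableEq ι] (g : O → O') (r : ι → Bool) (j : ι)
    (S : Strategy ι O) : (S.map g).input r j = S.input r j := by
  induction S with
  | output o => rfl
  | use i x next ih => simp [map, input, ih]

theorem result_relabel (g : ι → κ) (r : κ → Bool) (S : Strategy ι O) :
    (S.relabel g).result r = S.result (r ∘ g) := by
  induction S with
  | output o => rfl
  | use i x next ih => exact ih _

/-- The second phase never touches the copies of the first, so a copy left unused by the first phase
keeps the default input. This is the base case of `input_bind_inl`. -/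
theorem input_relabel_inr_inl [DecidableEq ι] [DecidableEq κ] (r : ι ⊕ κ → Bool) (j : ι)
    (S : Strategy κ O) : (S.relabel Sum.inr).input r (Sum.inl j) = false := by
  induction S with
  | output o => rfl
  | use i x next ih => simp [relabel, input, ih]

theorem input_relabel_inr_inr [DecidableEq ι] [DecidableEq κ] (r : ι ⊕ κ → Bool) (j : κ)
    (S : Strategy κ O) :
    (S.relabel Sum.inr).input r (Sum.inr j) = S.input (r ∘ Sum.inr) j := by
  induction S with
  | output o => rfl
  | use i x next ih => simp [relabel, input, ih]

theorem result_bind (k : O → Strategy κ O') (r : ι ⊕ κ → Bool) (S : Strategy ι O) :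
    (S.bind k).result r = (k (S.result (r ∘ Sum.inl))).result (r ∘ Sum.inr) := by
  induction S with
  | output o => exact result_relabel _ _ _
  | use i x next ih => exact ih _

theorem input_bind_inl [DecidableEq ι] [DecidableEq κ] (k : O → Strategy κ O')
    (r : ι ⊕ κ → Bool) (j : ι) (S : Strategy ι O) :
    (S.bind k).input r (Sum.inl j) = S.input (r ∘ Sum.inl) j := by
  induction S with
  | output o => exact input_relabel_inr_inl _ _ _
  | use i x next ih => simp [bind, input, ih]

theorem input_bind_inr [DecidableEq ι] [DecidableEq κ] (k : O → Strategy κ O')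
    (r : ι ⊕ κ → Bool) (j : κ) (S : Strategy ι O) :
    (S.bind k).input r (Sum.inr j) =
      (k (S.result (r ∘ Sum.inl))).input (r ∘ Sum.inr) j := by
  induction S with
  | output o => exact input_relabel_inr_inr _ _ _
  | use i x next ih => simp [bind, input, result, ih]

end Strategy

/-- The expectation of `F` on the outputs of two strategies that share copies of `P`. -/
noncomputable def expect (P : Box) {ι O O' : Type} [Fintype ι] [DecidableEq ι]
    (A : Strategy ι O) (B : Strategy ι O') (F : O → O' → ℝ) : ℝ :=
  ∑ a : ι → Bool, ∑ b : ι → Bool,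
    F (A.result a) (B.result b) * ∏ i, P (a i) (b i) (A.input a i) (B.input b i)

theorem sum_sumArrow {ι κ : Type} [Fintype ι] [Fintype κ] [DecidableEq ι] [DecidableEq κ]
    (f : (ι ⊕ κ → Bool) → ℝ) :
    ∑ a, f a = ∑ a : ι → Bool, ∑ c : κ → Bool, f (Sum.elim a c) := by
  rw [← Fintype.sum_prod_type']
  exact (Fintype.sum_equiv (Equiv.sumArrowEquivProdArrow ι κ Bool).symm _ _ fun _ => rfl).symm

section expect

variable (P : Box) {ι κ O O' U U' : Type} [Fintype ι] [DecidableEq ι] [Fintype κ] [DecidableEq κ]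

/-- The second phase runs on fresh copies, so the product of box entries splits into a factor for
`ι` and a factor for `κ`, and the latter depends on the first phase only through its two outputs. -/
theorem expect_bind (A : Strategy ι O) (B : Strategy ι O') (k : O → Strategy κ U)
    (l : O' → Strategy κ U') (F : U → U' → ℝ) :
    expect P (A.bind k) (B.bind l) F = expect P A B fun o o' => expect P (k o) (l o') F := by
  simp only [expect, sum_sumArrow, Strategy.result_bind, Fintype.prod_sum_type,
    Strategy.input_bind_inl, Strategy.input_bind_inr, Sum.elim_comp_inl, Sum.elim_comp_inr,
    Sum.elim_inl, Sum.elim_inr, Finset.sum_mul]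
  refine Finset.sum_congr rfl fun a _ => ?_
  rw [Finset.sum_comm]
  refine Finset.sum_congr rfl fun b _ => Finset.sum_congr rfl fun c _ =>
    Finset.sum_congr rfl fun d _ => ?_
  ring

theorem expect_sum {R : Type} [Fintype R] (p : R → ℝ) (A : Strategy ι O) (B : Strategy ι O')
    (F : R → O → O' → ℝ) :
    expect P A B (fun o o' => ∑ r, p r * F r o o') = ∑ r, p r * expect P A B (F r) := by
  simp only [expect, Finset.sum_mul, Finset.mul_sum]
  rw [Finset.sum_comm]
  conv_rhs => rw [Finset.sum_comm]; enter [2, a]; rw [Finset.sum_comm]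
  rw [Finset.sum_comm]
  refine Finset.sum_congr rfl fun a _ => Finset.sum_congr rfl fun b _ =>
    Finset.sum_congr rfl fun r _ => ?_
  ring

end expect

/-! ### Gadgets: pairs of strategies with shared randomness -/

/-- A pair of strategies that use copies of a box and shared randomness, and that turn local inputs
in `U`, `V` into local outputs in `O`, `O'`. -/
structure Gadget (U V O O' : Type) where
  Copy : Type
  [fintypeCopy : Fintype Copy]
  [decidableEqCopy : DecidableEq Copy]
  Rand : Type
  [fintypeRand : Fintype Rand]
  prob : Rand → ℝ
  prob_nonneg : ∀ r, 0 ≤ prob r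
  prob_sum : ∑ r, prob r = 1
  alice : U → Rand → Strategy Copy O
  bob : V → Rand → Strategy Copy O'

attribute [instance] Gadget.fintypeCopy Gadget.decidableEqCopy Gadget.fintypeRand

namespace Gadget

variable {U V O O' W W' : Type}

/-- The expectation of `F` on the outputs of a gadget that uses copies of `P`. -/
noncomputable def eval (G : Gadget U V O O') (P : Box) (u : U) (v : V) (F : O → O' → ℝ) : ℝ :=
  ∑ r, G.prob r * expect P (G.alice u r) (G.bob v r) F

theorem eval_add (G : Gadget U V O O') (P : Box) (u : U) (v : V) (F F' : O → O' → ℝ) :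
    G.eval P u v (fun o o' => F o o' + F' o o') = G.eval P u v F + G.eval P u v F' := by
  simp only [eval, expect, add_mul, Finset.sum_add_distrib, mul_add]

theorem eval_const_mul (G : Gadget U V O O') (P : Box) (u : U) (v : V) (c : ℝ)
    (F : O → O' → ℝ) :
    G.eval P u v (fun o o' => c * F o o') = c * G.eval P u v F := by
  simp only [eval, expect, Finset.mul_sum]
  refine Finset.sum_congr rfl fun r _ => Finset.sum_congr rfl fun a _ =>
    Finset.sum_congr rfl fun b _ => ?_
  ring

/-- Preprocess the inputs locally. -/
def comap {U' V' : Type} (f : U' → U) (g : V' → V) (G : Gadget U V O O') : Gadget U' V' O O' where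
  Copy := G.Copy
  Rand := G.Rand
  prob := G.prob
  prob_nonneg := G.prob_nonneg
  prob_sum := G.prob_sum
  alice u := G.alice (f u)
  bob v := G.bob (g v)

@[simp] theorem eval_comap {U' V' : Type} (f : U' → U) (g : V' → V) (G : Gadget U V O O') (P : Box)
    (u : U') (v : V') (F : O → O' → ℝ) :
    (G.comap f g).eval P u v F = G.eval P (f u) (g v) F := rfl

/-- Run a gadget and then another one, whose inputs are those of the first together with its
outputs. -/
def bind (G : Gadget U V O O') (H : Gadget (U × O) (V × O') W W') : Gadget U V W W' where
  Copy := G.Copy ⊕ H.Copy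
  Rand := G.Rand × H.Rand
  prob r := G.prob r.1 * H.prob r.2
  prob_nonneg r := mul_nonneg (G.prob_nonneg _) (H.prob_nonneg _)
  prob_sum := by
    rw [Fintype.sum_prod_type]
    simp [← Finset.mul_sum, G.prob_sum, H.prob_sum]
  alice u r := (G.alice u r.1).bind fun o => H.alice (u, o) r.2
  bob v r := (G.bob v r.1).bind fun o => H.bob (v, o) r.2

@[simp] theorem eval_bind (G : Gadget U V O O') (H : Gadget (U × O) (V × O') W W') (P : Box)
    (u : U) (v : V) (F : W → W' → ℝ) :
    (G.bind H).eval P u v F = G.eval P u v fun o o' => H.eval P (u, o) (v, o') F := by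
  have h : (G.bind H).eval P u v F = ∑ r : G.Rand × H.Rand, G.prob r.1 * H.prob r.2 *
      expect P ((G.alice u r.1).bind fun o => H.alice (u, o) r.2)
        ((G.bob v r.1).bind fun o => H.bob (v, o) r.2) F := rfl
  rw [h, Fintype.sum_prod_type]
  simp only [eval, expect_bind, expect_sum, Finset.mul_sum, mul_assoc]

/-- Local processing of the inputs and of a uniformly distributed shared random variable. -/
noncomputable def shared {R : Type} [Fintype R] [Nonempty R] (f : U → R → O) (g : V → R → O') :
    Gadget U V O O' where
  Copy := Empty
  Rand := R
  prob _ := (Fintype.card R : ℝ)⁻¹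
  prob_nonneg _ := by positivity
  prob_sum := by simp
  alice u r := .output (f u r)
  bob v r := .output (g v r)

@[simp] theorem eval_shared {R : Type} [Fintype R] [Nonempty R] (f : U → R → O) (g : V → R → O')
    (P : Box) (u : U) (v : V) (F : O → O' → ℝ) :
    (shared f g).eval P u v F = ∑ r, (Fintype.card R : ℝ)⁻¹ * F (f u r) (g v r) := by
  have h : (shared f g).eval P u v F = ∑ r, (Fintype.card R : ℝ)⁻¹ *
      expect P (ι := Empty) (.output (f u r)) (.output (g v r)) F := rfl
  rw [h]
  simp [expect, Strategy.result]

/-- Deterministic local processing. -/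
noncomputable def pure (f : U → O) (g : V → O') : Gadget U V O O' :=
  shared (fun u (_ : Unit) => f u) (fun v _ => g v)

@[simp] theorem eval_pure (f : U → O) (g : V → O') (P : Box) (u : U) (v : V) (F : O → O' → ℝ) :
    (pure f g).eval P u v F = F (f u) (g v) := by
  simp [pure]

/-- A single use of one copy. -/
def single : Gadget Bool Bool Bool Bool where
  Copy := Unit
  Rand := Unit
  prob _ := 1
  prob_nonneg _ := zero_le_one
  prob_sum := by simp
  alice x _ := .use () x .output
  bob y _ := .use () y .output

/-- The gadget `G`, if it uses copies of `P`, behaves like the box `Q`. -/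
def Realizes (G : Gadget Bool Bool Bool Bool) (P Q : Box) : Prop :=
  ∀ x y F, G.eval P x y F = ∑ a, ∑ b, Q a b x y * F a b

theorem realizes_single (P : Box) : single.Realizes P P := by
  intro x y F
  have h : single.eval P x y F = ∑ _r : Unit, 1 *
      expect P (ι := Unit) (.use () x .output) (.use () y .output) F := rfl
  rw [h]
  simp only [expect, Strategy.result, Strategy.input, ← (Equiv.funUnique Unit Bool).symm.sum_comp]
  simp [mul_comm]

/-- The gadget that implements the product of two boxes. -/
noncomputable def product (G H : Gadget Bool Bool Bool Bool) : Gadget Bool Bool Bool Bool :=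
  G.bind ((H.comap (fun s => s.1 && s.2) (fun t => t.1 && t.2)).bind
    (pure (fun s => xor s.1.2 s.2) (fun t => xor t.1.2 t.2)))

theorem Realizes.product {G H : Gadget Bool Bool Bool Bool} {P Q Q' : Box}
    (hG : G.Realizes P Q) (hH : H.Realizes P Q') : (G.product H).Realizes P (mul Q Q') := by
  intro x y F
  simp only [Gadget.product, eval_bind, eval_comap, eval_pure, hH _ _ _, hG _ _ _]
  simp [mul]
  ring

theorem exists_realizes_rightPow (P : Box) (k : ℕ) : ∃ G : Gadget Bool Bool Bool Bool,
    G.Realizes P ((fun Q => mul Q P)^[k] P) := by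
  induction k with
  | zero => exact ⟨single, realizes_single P⟩
  | succ k ih =>
    obtain ⟨G, hG⟩ := ih
    rw [Function.iterate_succ_apply']
    exact ⟨G.product single, hG.product (realizes_single P)⟩

end Gadget

/-! ### Correlations -/

/-- The sign `(-1)^b`. -/
def sign (b : Bool) : ℝ := if b then -1 else 1

theorem sign_xor (a b : Bool) : sign (xor a b) = sign a * sign b := by
  cases a <;> cases b <;> simp [sign]

theorem sign_mul_self (a : Bool) : sign a * sign a = 1 := by
  cases a <;> simp [sign]

namespace Gadget

variable {U V : Type}

/-- On inputs `u, v` the gadget, using copies of `P`, has total probability one and its output bits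
have the correlation `c u v`. -/
def Correlates (G : Gadget U V Bool Bool) (P : Box) (c : U → V → ℝ) : Prop :=
  ∀ u v, G.eval P u v (fun _ _ => 1) = 1 ∧ G.eval P u v (fun a b => sign (xor a b)) = c u v

/-- Twirling of a gadget that behaves like a box. -/
noncomputable def twirl (G : Gadget Bool Bool Bool Bool) : Gadget Bool Bool Bool Bool :=
  (shared (R := Bool × Bool) (fun _ r => r) (fun _ r => r)).bind
    ((G.comap (fun s => xor s.1 s.2.1) (fun t => xor t.1 t.2.2)).bind
      (pure (fun s => xor s.2 (xor (s.1.1 && s.1.2.2) (s.1.2.1 && s.1.2.2)))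
        (fun t => xor t.2 (t.1.1 && t.1.2.1))))

/-- The total probability of the outputs of a box is one on all inputs. -/
def Normalized (Q : Box) : Prop := ∀ x y, ∑ a, ∑ b, Q a b x y = 1

/-- With shared bits `α, β` the box is used on `x ⊕ α, y ⊕ β`. As `(x ⊕ α)(y ⊕ β) = xy ⊕ xβ ⊕ αβ ⊕
yα`, the corrections are local, and averaging over `α, β` replaces the four biases by their mean, `2
CHSH Q - 1`. -/
theorem Realizes.correlates_twirl {G : Gadget Bool Bool Bool Bool} {P Q : Box}
    (hG : G.Realizes P Q) (hQ : Normalized Q) :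
    G.twirl.Correlates P fun x y => (2 * CHSH Q - 1) * sign (x && y) := by
  have h00 := hQ false false
  have h01 := hQ false true
  have h10 := hQ true false
  have h11 := hQ true true
  simp only [Fintype.sum_bool] at h00 h01 h10 h11
  intro x y
  simp only [twirl, eval_bind, eval_comap, eval_pure, eval_shared, hG _ _ _]
  constructor <;> cases x <;> cases y <;>
    simp [Fintype.sum_prod_type, sign, CHSH] <;> linarith

/-- Distributed computation of the majority of three distributed bits, each produced by `G`, by two
uses of `N`. -/
noncomputable def majority (G : Gadget U V Bool Bool) (N : Gadget Bool Bool Bool Bool) :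
    Gadget U V Bool Bool :=
  G.bind ((G.comap Prod.fst Prod.fst).bind ((G.comap (fun s => s.1.1) (fun t => t.1.1)).bind
    ((N.comap (fun s => xor s.1.1.2 s.1.2) (fun t => xor t.1.2 t.2)).bind
      ((N.comap (fun s => xor s.1.1.2 s.1.2) (fun t => xor t.1.1.1.2 t.1.1.2)).bind
        (pure
          (fun s => xor (xor s.1.2 s.2)
            (xor (xor s.1.1.1.1.2 s.1.1.1.2 && xor s.1.1.1.2 s.1.1.2) s.1.1.1.2))
          (fun t => xor (xor t.1.2 t.2)
            (xor (xor t.1.1.1.1.2 t.1.1.1.2 && xor t.1.1.1.2 t.1.1.2) t.1.1.1.2)))))))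

/-- Over the field of two elements the majority of `z₁, z₂, z₃` is `(z₁ + z₂)(z₂ + z₃) + z₂`. For
`zᵢ = aᵢ + bᵢ` all terms are local except two cross products, each the target of one use of a `PR`
box. The right side is the Fourier expansion of majority. -/
theorem sign_majority (a₁ a₂ a₃ b₁ b₂ b₃ : Bool) :
    sign (xor (xor (xor a₁ a₂ && xor a₂ a₃) a₂) (xor (xor b₁ b₂ && xor b₂ b₃) b₂)) *
        (sign (xor a₁ a₂ && xor b₂ b₃) * sign (xor a₂ a₃ && xor b₁ b₂)) =
      (1 / 2) * (sign (xor a₁ b₁) + sign (xor a₂ b₂) + sign (xor a₃ b₃)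
        - sign (xor a₁ b₁) * sign (xor a₂ b₂) * sign (xor a₃ b₃)) := by
  cases a₁ <;> cases a₂ <;> cases a₃ <;> cases b₁ <;> cases b₂ <;> cases b₃ <;>
    norm_num [sign]

theorem Correlates.majority {G : Gadget U V Bool Bool} {N : Gadget Bool Bool Bool Bool} {P : Box}
    {c : U → V → ℝ} {θ : ℝ} (hG : G.Correlates P c)
    (hN : N.Correlates P fun x y => θ * sign (x && y)) :
    (G.majority N).Correlates P fun u v => θ ^ 2 * (3 * c u v - c u v ^ 3) / 2 := by
  intro u v
  have hG1 := (hG u v).1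
  have hGc := (hG u v).2
  -- The expansion of majority is affine in each of the three signs, so the three runs of `G` can be
  -- averaged out one at a time, each replacing a sign by `c u v`.
  have hlin : ∀ p q : ℝ,
      G.eval P u v (fun a b => p + q * sign (xor a b)) = p + q * c u v := by
    intro p q
    have h1 := G.eval_const_mul P u v p (fun _ _ => 1)
    simp only [mul_one, hG1] at h1
    rw [G.eval_add P u v (fun _ _ => p), h1, G.eval_const_mul, hGc]
  constructor
  · simp only [Gadget.majority, eval_bind, eval_comap, eval_pure, hG1, (hN _ _).1]
  · have hN' : ∀ (x y x' y' : Bool) (d : Bool → Bool), N.eval P x y (fun o p => N.eval P x' y' fun o' p' =>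
        sign (xor (xor (xor o o') (d false)) (xor (xor p p') (d true)))) =
        θ ^ 2 * (sign (xor (d false) (d true)) * (sign (x && y) * sign (x' && y'))) := by
      intro x y x' y' d
      have h (o p o' p' : Bool) :
          sign (xor (xor (xor o o') (d false)) (xor (xor p p') (d true))) =
          sign (xor (d false) (d true)) * sign (xor o p) * sign (xor o' p') := by
        simp only [sign_xor]
        ring
      simp only [h, N.eval_const_mul, (hN _ _).2]
      have h' (o p : Bool) : sign (xor (d false) (d true)) * sign (xor o p) *
          (θ * sign (x' && y')) =
          (sign (xor (d false) (d true)) * (θ * sign (x' && y'))) * sign (xor o p) := by ring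
      simp only [h', N.eval_const_mul, (hN _ _).2]
      ring
    have hN'' (x y x' y' d e : Bool) := hN' x y x' y' (fun i => bif i then e else d)
    simp only [cond_true, cond_false] at hN''
    simp only [Gadget.majority, eval_bind, eval_comap, eval_pure, hN'', sign_majority]
    have h3 (a₁ a₂ a₃ b₁ b₂ b₃ : Bool) :
        θ ^ 2 * (1 / 2 * (sign (xor a₁ b₁) + sign (xor a₂ b₂) + sign (xor a₃ b₃)
          - sign (xor a₁ b₁) * sign (xor a₂ b₂) * sign (xor a₃ b₃))) =
        θ ^ 2 / 2 * (sign (xor a₁ b₁) + sign (xor a₂ b₂)) +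
          θ ^ 2 / 2 * (1 - sign (xor a₁ b₁) * sign (xor a₂ b₂)) * sign (xor a₃ b₃) := by ring
    simp only [h3, hlin]
    have h2 (a₁ a₂ b₁ b₂ : Bool) :
        θ ^ 2 / 2 * (sign (xor a₁ b₁) + sign (xor a₂ b₂)) +
          θ ^ 2 / 2 * (1 - sign (xor a₁ b₁) * sign (xor a₂ b₂)) * c u v =
        θ ^ 2 / 2 * (sign (xor a₁ b₁) + c u v) +
          θ ^ 2 / 2 * (1 - sign (xor a₁ b₁) * c u v) * sign (xor a₂ b₂) := by ring
    simp only [h2, hlin]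
    have h1 (a₁ b₁ : Bool) :
        θ ^ 2 / 2 * (sign (xor a₁ b₁) + c u v) +
          θ ^ 2 / 2 * (1 - sign (xor a₁ b₁) * c u v) * c u v =
        θ ^ 2 / 2 * (2 * c u v) +
          θ ^ 2 / 2 * (1 - c u v ^ 2) * sign (xor a₁ b₁) := by ring
    simp only [h1, hlin]
    ring

/-- Alice evaluates `f` at a shared random guess of Bob's input, and Bob outputs a random bit unless
the guess is right. -/
noncomputable def guess {n : ℕ} (f : (Fin n → Bool) → (Fin n → Bool) → Bool) :
    Gadget (Fin n → Bool) (Fin n → Bool) Bool Bool :=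
  shared (R := (Fin n → Bool) × Bool) (fun X r => f X r.1)
    (fun Y r => if Y = r.1 then false else r.2)

theorem correlates_guess {n : ℕ} (f : (Fin n → Bool) → (Fin n → Bool) → Bool) (P : Box) :
    (guess f).Correlates P fun X Y => (2 ^ n : ℝ)⁻¹ * sign (f X Y) := by
  intro X Y
  constructor
  · simp [guess]
    field_simp
  -- For a wrong guess Bob's random bit averages the correlation to zero; the right one has
  -- probability `2⁻ⁿ`.
  · have h (Z : Fin n → Bool) :
        ∑ r : Bool, sign (xor (f X Z) (if Y = Z then false else r)) =
          if Y = Z then 2 * sign (f X Y) else 0 := by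
      by_cases hZ : Y = Z
      · subst hZ
        simp
      · cases f X Z <;> simp [hZ, sign]
    simp only [guess, eval_shared, ← Finset.mul_sum, Fintype.sum_prod_type, h]
    simp
    ring

/-- The protocol in which Bob sends his output bit and Alice adds it to hers. -/
def toProtocol {n : ℕ} (G : Gadget (Fin n → Bool) (Fin n → Bool) Bool Bool) : Protocol n where
  Copy := G.Copy
  Rand := G.Rand
  prob := G.prob
  prob_nonneg := G.prob_nonneg
  prob_sum := G.prob_sum
  alice X r c := (G.alice X r).map fun a => xor a c
  bob := G.bob

theorem outputProb_toProtocol {n : ℕ} (G : Gadget (Fin n → Bool) (Fin n → Bool) Bool Bool)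
    (P : Box) (X Y : Fin n → Bool) (w : Bool) :
    G.toProtocol.outputProb P X Y w =
      G.eval P X Y fun a b => if xor a b = w then 1 else 0 := by
  have h : G.toProtocol.outputProb P X Y w = ∑ r, G.prob r * ∑ a : G.Copy → Bool,
      ∑ b : G.Copy → Bool,
        if ((G.alice X r).map fun a => xor a ((G.bob Y r).result b)).result a = w then
          ∏ i, P (a i) (b i) (((G.alice X r).map fun a => xor a ((G.bob Y r).result b)).input a i)
            ((G.bob Y r).input b i) else 0 := rfl
  rw [h]
  simp only [eval, expect, Strategy.result_map, Strategy.input_map, ite_mul, one_mul, zero_mul]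

theorem Correlates.outputProb_toProtocol {n : ℕ}
    {G : Gadget (Fin n → Bool) (Fin n → Bool) Bool Bool} {P : Box}
    {f : (Fin n → Bool) → (Fin n → Bool) → Bool} {δ : ℝ}
    (hG : G.Correlates P fun X Y => δ * sign (f X Y)) (X Y : Fin n → Bool) :
    G.toProtocol.outputProb P X Y (f X Y) = (1 + δ) / 2 := by
  rw [Gadget.outputProb_toProtocol]
  have h (a b : Bool) : (if xor a b = f X Y then (1 : ℝ) else 0) =
      (1 / 2) * 1 + (sign (f X Y) / 2) * sign (xor a b) := by
    cases xor a b <;> cases f X Y <;> norm_num [sign]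
  simp only [h, G.eval_add P X Y (fun _ _ => 1 / 2 * 1), G.eval_const_mul, (hG X Y).1, (hG X Y).2]
  linear_combination (δ / 2) * sign_mul_self (f X Y)

end Gadget

/-! ### Amplification and the collapsing threshold -/

open Gadget in
/-- Amplification: noisy copies of `PR` with correlation `θ`, where `θ² > 2/3`, collapse
communication complexity. -/
theorem collapses_of_correlates {P : Box} {N : Gadget Bool Bool Bool Bool} {θ : ℝ}
    (hN : N.Correlates P fun x y => θ * sign (x && y)) (hθ : 2 / 3 < θ ^ 2) : Collapses P := by
  set κ := θ ^ 2
  have hκ : 0 < κ := by linarith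
  -- The growth factor at bias `δ` is `(3κ - κδ²) / 2`. This `ε` makes it equal to `(3κ + 2) / 4 >
  -- 1` at `δ = ε`, hence at least that below `ε`.
  set ε := √((3 * κ - 2) / (2 * κ))
  have hε2 : κ * ε ^ 2 = (3 * κ - 2) / 2 := by
    rw [Real.sq_sqrt (div_nonneg (by linarith) (by linarith))]
    field_simp
  have hε : 0 < ε := Real.sqrt_pos.2 (div_pos (by linarith) (by linarith))
  refine ⟨(1 + ε) / 2, by linarith, fun n f => ?_⟩
  suffices h : ∃ (δ : ℝ) (G : Gadget (Fin n → Bool) (Fin n → Bool) Bool Bool),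
      ε ≤ δ ∧ G.Correlates P fun X Y => δ * sign (f X Y) by
    obtain ⟨δ, G, hδ, hG⟩ := h
    refine ⟨G.toProtocol, fun X Y => ?_⟩
    rw [hG.outputProb_toProtocol]
    linarith
  -- If no gadget reached `ε`, every majority step would gain the factor `(3κ + 2) / 4`, and the
  -- bias would grow without bound.
  by_contra! hcon
  have hgrow (k : ℕ) : ∃ (δ : ℝ) (G : Gadget (Fin n → Bool) (Fin n → Bool) Bool Bool),
      ((3 * κ + 2) / 4) ^ k * (2 ^ n : ℝ)⁻¹ ≤ δ ∧ G.Correlates P fun X Y => δ * sign (f X Y) := by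
    induction k with
    | zero => exact ⟨_, guess f, by simp, correlates_guess f P⟩
    | succ k ih =>
      obtain ⟨δ, G, hδ, hG⟩ := ih
      have hδ0 : 0 < δ := lt_of_lt_of_le (by positivity) hδ
      have hδε : δ < ε := by
        by_contra! h
        exact hcon δ G h hG
      refine ⟨κ * (3 * δ - δ ^ 3) / 2, G.majority N, ?_, ?_⟩
      · have h1 : κ * δ ^ 2 ≤ (3 * κ - 2) / 2 := by
          rw [← hε2]
          gcongr
        calc ((3 * κ + 2) / 4) ^ (k + 1) * (2 ^ n : ℝ)⁻¹
            = ((3 * κ + 2) / 4) * (((3 * κ + 2) / 4) ^ k * (2 ^ n : ℝ)⁻¹) := by ring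
          _ ≤ ((3 * κ + 2) / 4) * δ := by gcongr
          _ ≤ ((3 * κ - κ * δ ^ 2) / 2) * δ := by
              refine mul_le_mul_of_nonneg_right ?_ hδ0.le
              linarith
          _ = κ * (3 * δ - δ ^ 3) / 2 := by ring
      · convert hG.majority hN using 3 with X Y
        -- A sign equals its own cube.
        linear_combination (κ * δ ^ 3 / 2 * sign (f X Y)) * sign_mul_self (f X Y)
  obtain ⟨k, hk⟩ := pow_unbounded_of_one_lt (ε * 2 ^ n) (show 1 < (3 * κ + 2) / 4 by linarith)
  obtain ⟨δ, G, hδ, hG⟩ := hgrow k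
  refine hcon δ G ?_ hG
  refine le_trans ?_ hδ
  rw [← div_eq_mul_inv, le_div_iff₀ (by positivity)]
  exact hk.le

theorem Gadget.Realizes.collapses {G : Gadget Bool Bool Bool Bool} {P Q : Box}
    (hG : G.Realizes P Q) (hQ : Normalized Q) (h : (3 + √6) / 6 < CHSH Q) : Collapses P := by
  refine collapses_of_correlates (hG.correlates_twirl hQ) ?_
  have h6 : √6 ^ 2 = 6 := Real.sq_sqrt (by norm_num)
  have h6' := Real.sqrt_nonneg 6
  have h1 : √6 / 3 < 2 * CHSH Q - 1 := by linarith
  calc (2 / 3 : ℝ) = (√6 / 3) ^ 2 := by rw [div_pow, h6]; norm_num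
    _ < _ := by gcongr

theorem NS.normalized {P : Box} (hP : P ∈ NS) : Gadget.Normalized P := hP.2.1

theorem Gadget.Normalized.mul {P Q : Box} (hP : Normalized P) (hQ : Normalized Q) :
    Normalized (mul P Q) := by
  intro x y
  have h : ∑ a, ∑ b, NonlocalBox.mul P Q a b x y =
      ∑ a₁, ∑ b₁, P a₁ b₁ x y * ∑ a₂, ∑ b₂, Q a₂ b₂ (x && a₁) (y && b₁) := by
    simp [NonlocalBox.mul]
    ring
  rw [h]
  simp only [hQ _ _, mul_one, hP x y]

theorem Gadget.Normalized.iterate_mul {P : Box} (hP : Normalized P) (k : ℕ) :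
    Normalized ((fun Q => NonlocalBox.mul Q P)^[k] P) := by
  induction k with
  | zero => exact hP
  | succ k ih =>
    rw [Function.iterate_succ_apply']
    exact ih.mul hP

/-- Copies of `P` simulate its power, so a protocol for the power is one for `P`. Only normalization
has to survive the products. -/
theorem collapses_of_rightPow {P : Box} (hP : P ∈ NS) (k : ℕ)
    (h : (3 + √6) / 6 < CHSH (rightPow P k)) : Collapses P := by
  obtain ⟨G, hG⟩ := Gadget.exists_realizes_rightPow P (k - 1)
  exact hG.collapses ((NS.normalized hP).iterate_mul _) h

/-! ### The plane -/

/-- The box of the plane with `𝔼 (-1)^(a ⊕ b)` equal to `s` if `x y = 0` and to `t` if `x y = 1`. -/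
noncomputable def planeBox (s t : ℝ) : Box := fun a b x y =>
  (1 + sign (xor a b) * if (x && y) then t else s) / 4

theorem planeBox_mem_planeA (s t : ℝ) : planeBox s t ∈ planeA := by
  have hPR : boxPR ∈ planeA := subset_affineSpan ℝ _ (by simp)
  have hSR : boxSR ∈ planeA := subset_affineSpan ℝ _ (by simp)
  have hI : boxI ∈ planeA := subset_affineSpan ℝ _ (by simp)
  -- With `I` as origin, `SR` has coordinates `(1, 1)` and `PR` has `(1, -1)`, so `(s, t)` is their
  -- combination with weights `(s + t) / 2` and `(s - t) / 2`.
  have h := AffineSubspace.smul_vsub_vadd_mem _ ((s - t) / 2) hPR hI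
    (AffineSubspace.smul_vsub_vadd_mem _ ((s + t) / 2) hSR hI hI)
  convert h using 1
  ext a b x y
  cases a <;> cases b <;> cases x <;> cases y <;>
    simp [planeBox, boxPR, boxSR, boxI, boxP0, boxP1, sign] <;> ring

theorem exists_eq_planeBox {P : Box} (hP : P ∈ planeA) : ∃ s t, P = planeBox s t := by
  refine affineSpan_induction hP (fun x hx => ?_) fun c u v w hu hv hw => ?_
  · rcases hx with rfl | rfl | rfl
    · refine ⟨1, -1, ?_⟩
      ext a b x y
      cases a <;> cases b <;> cases x <;> cases y <;> norm_num [planeBox, boxPR, sign]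
    · refine ⟨1, 1, ?_⟩
      ext a b x y
      cases a <;> cases b <;> cases x <;> cases y <;>
        norm_num [planeBox, boxSR, boxP0, boxP1, sign]
    · refine ⟨0, 0, ?_⟩
      ext a b x y
      simp [planeBox, boxI]
  · obtain ⟨s₁, t₁, rfl⟩ := hu
    obtain ⟨s₂, t₂, rfl⟩ := hv
    obtain ⟨s₃, t₃, rfl⟩ := hw
    refine ⟨c * (s₁ - s₂) + s₃, c * (t₁ - t₂) + t₃, ?_⟩
    ext a b x y
    cases h : (x && y) <;> simp [planeBox, h] <;> ring

theorem CHSH_planeBox (s t : ℝ) : CHSH (planeBox s t) = 1 / 2 + (3 * s - t) / 8 := by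
  simp [CHSH, planeBox, sign]
  ring

theorem CHSH'_planeBox (s t : ℝ) : CHSH' (planeBox s t) = 1 / 2 + (s + t) / 8 := by
  simp [CHSH', planeBox, sign]
  ring

/-- If `xy = 0`, the second box also gets inputs of product zero, so correlations multiply. If `x =
y = 1`, its inputs are `a₁, b₁`: the correlation is `t'` on `(1, 1)`, of weight `(1 + t) / 4`, and
`s'` on the other three pairs, whose signed weights add up to `(3t - 1) / 4`. -/
theorem mul_planeBox (s t s' t' : ℝ) : mul (planeBox s t) (planeBox s' t') =
    planeBox (s * s') (((3 * t - 1) * s' + (1 + t) * t') / 4) := by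
  ext a b x y
  cases a <;> cases b <;> cases x <;> cases y <;> simp [mul, planeBox, sign] <;> ring

theorem eq_planeBox_of_CHSH {P : Box} (hP : P ∈ planeA) (h' : CHSH' P = 0.627)
    (h : CHSH P = 0.862) : P = planeBox 0.978 0.038 := by
  obtain ⟨s, t, rfl⟩ := exists_eq_planeBox hP
  rw [CHSH_planeBox] at h
  rw [CHSH'_planeBox] at h'
  have hs : s = 0.978 := by linarith
  have ht : t = 0.038 := by linarith
  rw [hs, ht]

theorem planeBox_mem_NS {s t : ℝ} (hs : |s| ≤ 1) (ht : |t| ≤ 1) : planeBox s t ∈ NS := by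
  rw [abs_le] at hs ht
  refine ⟨fun a b x y => ?_, fun x y => ?_, fun a x y y' => ?_, fun b x x' y => ?_⟩
  · cases h : (x && y) <;> cases h' : xor a b <;> simp [planeBox, h, h', sign] <;> linarith
  · cases h : (x && y) <;> simp [planeBox, h, sign] <;> ring
  · cases a <;> cases h : (x && y) <;> cases h' : (x && y') <;>
      simp [planeBox, h, h', sign] <;> ring
  · cases b <;> cases h : (x && y) <;> cases h' : (x' && y) <;>
      simp [planeBox, h, h', sign] <;> ring

/-- A non-signalling box with positive entries is in the relative interior of `NS`. -/
theorem notMem_intrinsicFrontier_NS {P : Box} (hP : P ∈ NS) (hpos : ∀ a b x y, 0 < P a b x y) :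
    P ∉ intrinsicFrontier ℝ NS := by
  rw [mem_intrinsicFrontier]
  rintro ⟨⟨P', hP'⟩, hfr, rfl⟩
  -- The equality constraints persist on the affine span, so the boxes of the span with positive
  -- entries form an open neighbourhood of the point inside `NS`.
  refine hfr.2 (mem_interior.2
    ⟨{Q | ∀ a b x y, 0 < (Q : Box) a b x y}, fun Q hQ => ?_, ?_, hpos⟩)
  · obtain ⟨Q, hQs⟩ := Q
    have key : (∀ x y, ∑ a, ∑ b, Q a b x y = 1) ∧
        (∀ a x y y', ∑ b, Q a b x y = ∑ b, Q a b x y') ∧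
        (∀ b x x' y, ∑ a, Q a b x y = ∑ a, Q a b x' y) := by
      clear hQ
      refine affineSpan_induction hQs (fun R hR => hR.2) fun c R₁ R₂ R₃ h₁ h₂ h₃ => ?_
      · refine ⟨fun x y => ?_, fun a x y y' => ?_, fun b x x' y => ?_⟩
        · have e₁ := h₁.1 x y
          have e₂ := h₂.1 x y
          have e₃ := h₃.1 x y
          simp only [Fintype.sum_bool] at e₁ e₂ e₃
          simp
          linear_combination c * (e₁ - e₂) + e₃
        · have e₁ := h₁.2.1 a x y y'
          have e₂ := h₂.2.1 a x y y'
          have e₃ := h₃.2.1 a x y y'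
          simp only [Fintype.sum_bool] at e₁ e₂ e₃
          simp
          linear_combination c * (e₁ - e₂) + e₃
        · have e₁ := h₁.2.2 b x x' y
          have e₂ := h₂.2.2 b x x' y
          have e₃ := h₃.2.2 b x x' y
          simp only [Fintype.sum_bool] at e₁ e₂ e₃
          simp
          linear_combination c * (e₁ - e₂) + e₃
    exact ⟨fun a b x y => (hQ a b x y).le, key⟩
  · simp only [Set.ofPred_forall]
    refine isOpen_iInter_of_finite fun a => isOpen_iInter_of_finite fun b =>
      isOpen_iInter_of_finite fun x => isOpen_iInter_of_finite fun y => ?_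
    exact isOpen_lt continuous_const ((continuous_apply y).comp ((continuous_apply x).comp
      ((continuous_apply b).comp ((continuous_apply a).comp continuous_subtype_val))))

/-! ### The box with coordinates `(0.627, 0.862)` -/

theorem threshold_bounds : 0.908 < (3 + √6) / 6 ∧ (3 + √6) / 6 < 0.9085 := by
  have h1 : (2.448 : ℝ) < √6 := Real.lt_sqrt_of_sq_lt (by norm_num)
  have h2 : √6 < (2.451 : ℝ) := (Real.sqrt_lt' (by norm_num)).2 (by norm_num)
  constructor <;> linarith

theorem CHSH_rightPow_five : 0.9135 < CHSH (rightPow (planeBox 0.978 0.038) 5) ∧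
    CHSH (rightPow (planeBox 0.978 0.038) 5) < 0.9136 := by
  have h : rightPow (planeBox 0.978 0.038) 5 = mul (mul (mul (mul (planeBox 0.978 0.038)
    (planeBox 0.978 0.038)) (planeBox 0.978 0.038)) (planeBox 0.978 0.038))
    (planeBox 0.978 0.038) := rfl
  rw [h, mul_planeBox, mul_planeBox, mul_planeBox, mul_planeBox, CHSH_planeBox]
  constructor <;> norm_num

theorem abs_mul_self_planeBox_le {s t : ℝ} (hs : |s| ≤ 1) (ht : |t| ≤ 1) :
    |((3 * t - 1) * s + (1 + t) * t) / 4| ≤ 1 := by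
  rw [abs_le] at *
  constructor
  · nlinarith [mul_nonneg (sub_nonneg.2 hs.2) (sub_nonneg.2 ht.2),
      mul_nonneg (sub_nonneg.2 hs.1) (sub_nonneg.2 ht.2),
      mul_nonneg (sub_nonneg.2 hs.2) (sub_nonneg.2 ht.1),
      mul_nonneg (sub_nonneg.2 hs.1) (sub_nonneg.2 ht.1),
      mul_nonneg (sub_nonneg.2 ht.1) (sub_nonneg.2 ht.2), sq_nonneg (1 + t)]
  · nlinarith [mul_nonneg (sub_nonneg.2 hs.2) (sub_nonneg.2 ht.2),
      mul_nonneg (sub_nonneg.2 hs.1) (sub_nonneg.2 ht.2),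
      mul_nonneg (sub_nonneg.2 hs.2) (sub_nonneg.2 ht.1),
      mul_nonneg (sub_nonneg.2 hs.1) (sub_nonneg.2 ht.1),
      mul_nonneg (sub_nonneg.2 ht.1) (sub_nonneg.2 ht.2), sq_nonneg (1 + t)]

/-- For late iterates only the exact decay of `s` matters; about `t` it suffices that it stays in
`[-1, 1]`. -/
theorem exists_iterate_mul_self_eq {s t : ℝ} (hs : |s| ≤ 1) (ht : |t| ≤ 1) (n : ℕ) :
    ∃ t', (fun Q => mul Q Q)^[n] (planeBox s t) = planeBox (s ^ 2 ^ n) t' ∧ |t'| ≤ 1 := by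
  induction n with
  | zero => exact ⟨t, by simp, ht⟩
  | succ n ih =>
    obtain ⟨t', h, h2⟩ := ih
    refine ⟨_, ?_, abs_mul_self_planeBox_le (s := s ^ 2 ^ n) ?_ h2⟩
    · rw [Function.iterate_succ_apply', h, mul_planeBox]
      congr 1
      ring
    · rw [abs_pow]
      exact pow_le_one₀ (abs_nonneg s) hs

theorem CHSH_pairwiseIter_le (n : ℕ) (hn : 1 ≤ n) :
    CHSH (pairwiseIter (planeBox 0.978 0.038) n) ≤ 0.908 := by
  obtain ⟨n, rfl⟩ := Nat.exists_eq_add_of_le' hn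
  simp only [pairwiseIter, Nat.add_sub_cancel]
  -- From the fifth box on, `s ≤ 0.978¹⁶ ≤ 0.71` and `t ≥ -1` bound `CHSH` by about `0.892`. At the
  -- fourth, `s = 0.978⁸` is still too large for this bound, so four cases are computed.
  rcases n with _ | _ | _ | _ | n
  · simp only [Function.iterate_zero, id, CHSH_planeBox]
    norm_num
  · simp only [Function.iterate_succ_apply, Function.iterate_zero, id, mul_planeBox, CHSH_planeBox]
    norm_num
  · simp only [Function.iterate_succ_apply, Function.iterate_zero, id, mul_planeBox, CHSH_planeBox]
    norm_num
  · simp only [Function.iterate_succ_apply, Function.iterate_zero, id, mul_planeBox, CHSH_planeBox]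
    norm_num
  · obtain ⟨t', h, ht⟩ := exists_iterate_mul_self_eq (s := 0.978) (t := 0.038)
      (by norm_num [abs_of_nonneg]) (by norm_num [abs_of_nonneg]) (n + 4)
    rw [h, CHSH_planeBox]
    have h1 := (abs_le.1 ht).1
    have h2 : (0.978 : ℝ) ^ 2 ^ (n + 4) ≤ 0.978 ^ 2 ^ 4 :=
      pow_le_pow_of_le_one (by norm_num) (by norm_num) (Nat.pow_le_pow_right (by norm_num) (by simp))
    have h3 : (0.978 : ℝ) ^ 2 ^ 4 ≤ 0.71 := by norm_num
    linarith

theorem biasA_add_biasB_planeBox (s t : ℝ) :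
    biasA (planeBox s t) + biasB (planeBox s t) = (3 * s - t) ^ 2 + (6 * s ^ 2 + 2 * t ^ 2) := by
  simp [biasA, biasB, bias, planeBox, sign]
  ring

end NonlocalBox

theorem mainTheorem3 :
    -- the coordinates `(0.627, 0.862)` determine exactly one box of the plane
    (∃! P : NonlocalBox.Box, P ∈ NonlocalBox.planeA ∧
      NonlocalBox.CHSH' P = 0.627 ∧ NonlocalBox.CHSH P = 0.862) ∧
    -- `(3 + √6) / 6` is a collapsing threshold
    (∀ Q ∈ NonlocalBox.NS, (3 + √6) / 6 < NonlocalBox.CHSH Q → NonlocalBox.Collapses Q) ∧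
    ∀ P : NonlocalBox.Box, P ∈ NonlocalBox.planeA →
      NonlocalBox.CHSH' P = 0.627 → NonlocalBox.CHSH P = 0.862 →
      P ∈ NonlocalBox.NS ∧
      NonlocalBox.Collapses P ∧
      -- the fifth power exceeds the threshold
      (0.9135 < NonlocalBox.CHSH (NonlocalBox.rightPow P 5) ∧
        NonlocalBox.CHSH (NonlocalBox.rightPow P 5) < 0.9136 ∧
        (3 + √6) / 6 < NonlocalBox.CHSH (NonlocalBox.rightPow P 5)) ∧
      -- `P` lies outside the previously known collapsing regions
      P ≠ NonlocalBox.boxPR ∧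
      NonlocalBox.CHSH P < (3 + √6) / 6 ∧
      (|NonlocalBox.biasA P + NonlocalBox.biasB P - 14.13| < 0.005 ∧
        NonlocalBox.biasA P + NonlocalBox.biasB P < 16) ∧
      P ∉ intrinsicFrontier ℝ NonlocalBox.NS ∧
      (∀ n : ℕ, 1 ≤ n →
        NonlocalBox.CHSH (NonlocalBox.pairwiseIter P n) ≤ (3 + √6) / 6) := by

  have hNS : NonlocalBox.planeBox 0.978 0.038 ∈ NonlocalBox.NS :=
    NonlocalBox.planeBox_mem_NS (by norm_num [abs_of_nonneg]) (by norm_num [abs_of_nonneg])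
  obtain ⟨ht1, ht2⟩ := NonlocalBox.threshold_bounds
  have h5 := NonlocalBox.CHSH_rightPow_five
  have h5t := ht2.trans (lt_trans (by norm_num) h5.1)
  refine ⟨⟨NonlocalBox.planeBox 0.978 0.038, ⟨NonlocalBox.planeBox_mem_planeA _ _, ?_, ?_⟩,
    fun P hP => NonlocalBox.eq_planeBox_of_CHSH hP.1 hP.2.1 hP.2.2⟩, fun Q hQ h => ?_, ?_⟩
  · rw [NonlocalBox.CHSH'_planeBox]
    norm_num
  · rw [NonlocalBox.CHSH_planeBox]
    norm_num
  -- The first power of `Q` is `Q` by definition.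
  · exact NonlocalBox.collapses_of_rightPow hQ 1 h
  intro P hP h' h
  have hC := h
  obtain rfl := NonlocalBox.eq_planeBox_of_CHSH hP h' h
  refine ⟨hNS, NonlocalBox.collapses_of_rightPow hNS 5 h5t, ⟨h5.1, h5.2, h5t⟩, ?_, ?_, ?_, ?_, ?_⟩
  · intro hPR
    have := congrFun (congrFun (congrFun (congrFun hPR false) false) false) false
    norm_num [NonlocalBox.planeBox, NonlocalBox.boxPR, NonlocalBox.sign] at this
  · rw [hC]
    exact lt_trans (by norm_num) ht1
  · rw [NonlocalBox.biasA_add_biasB_planeBox, abs_lt]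
    norm_num
  · refine NonlocalBox.notMem_intrinsicFrontier_NS hNS fun a b x y => ?_
    cases h : (x && y) <;> cases h' : xor a b <;>
      norm_num [NonlocalBox.planeBox, h, h', NonlocalBox.sign]
  · intro n hn
    exact (NonlocalBox.CHSH_pairwiseIter_le n hn).trans ht1.le
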